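/- Let $H$ be a complex Hilbert space and let $T$ be a normal operator in $H$, i.e. a closed densely defined, possibly unbounded, linear operator with $TT^*=T^*T$. Write $\rho(\cdot)$ for the resolvent set and $\sigma(T)=\mathbb{C}\setminus\rho(T)$ for the spectrum. Let $p\in[0,1]$ and $c\ge 0$, and let $A$ be a linear operator in $H$ that is $p$-subordinate to $T$ with constant $c$, i.e. $\mathcal{D}(T)\subseteq\mathcal{D}(A)$ and $$\|Ax\|\le c\,\|x\|^{1-p}\|Tx\|^{p}\qquad\text{for all } x\in\mathcal{D}(T)$$ (with the convention $0^0=1$). Assume that there are real numbers $\alpha_T<\beta_T$ with $\{z\in\mathbb{C}:\alpha_T<\operatorname{Re}z<\beta_T\}\subseteq\rho(T)$ and that $\operatorname{Im}\sigma(T)\subseteq[-\gamma_T,\gamma_T]$ for some $\gamma_T\ge 0$. If $$2c\cdot\max\{|\alpha_T+i\gamma_T|^p,\,|\beta_T+i\gamma_T|^p\}<\beta_T-\alpha_T,$$ then $$\{z\in\mathbb{C}:\alpha'_{T,p}<\operatorname{Re}z<\beta'_{T,p}\}\subseteq\rho(T+A),$$ where $T+A$ has domain $\mathcal{D}(T)$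 and $$\alpha'_{T,p}:=\alpha_T+c\cdot\max\{|\alpha_T+i\gamma_T|^p,\,|\beta_T+i\gamma_T|^p\},\qquad \beta'_{T,p}:=\beta_T-c\cdot\max\{|\alpha_T+i\gamma_T|^p,\,|\beta_T+i\gamma_T|^p\}.$$ -/

import Mathlib

namespace UnboundedOp

variable {H : Type*} [NormedAddCommGroup H] [InnerProductSpace ℂ H]

/-- The product `S T` of two unbounded operators on its natural domain
`{x ∈ D(T) : T x ∈ D(S)}`. -/
def prod (S T : H →ₗ.[ℂ] H) : H →ₗ.[ℂ] H :=
  S.comp (T.domRestrict ((S.domain.comap T.toFun).map T.domain.subtype)) (by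
    rintro ⟨x, hx⟩
    obtain ⟨⟨y, hy, rfl⟩, hxT⟩ := hx
    exact hy)

/-- A closed densely defined operator `T` is normal if `T T* = T* T`
(equality of operators, including equality of the natural domains). -/
structure IsNormal [CompleteSpace H] (T : H →ₗ.[ℂ] H) : Prop where
  dense_domain : Dense (T.domain : Set H)
  isClosed : T.IsClosed
  comm : prod T T.adjoint = prod T.adjoint T

/-- The resolvent set: all `z` such that `T - z : D(T) → H` is bijective with bounded inverse. -/
def resolventSet (T : H →ₗ.[ℂ] H) : Set ℂ :=
  {z | Function.Bijective (fun x : T.domain => T x - z • (x : H)) ∧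
    ∃ C : ℝ, ∀ x : T.domain, ‖(x : H)‖ ≤ C * ‖T x - z • (x : H)‖}

/-- The spectrum, the complement of the resolvent set. -/
def spectrum (T : H →ₗ.[ℂ] H) : Set ℂ := (resolventSet T)ᶜ

/-- `A` is `p`-subordinate to `T` with constant `c`: `D(T) ⊆ D(A)` and
`‖A x‖ ≤ c ‖x‖ ^ (1 - p) ‖T x‖ ^ p` for all `x ∈ D(T)` (with `0 ^ 0 = 1`). -/
def IsSubordinateWith (A T : H →ₗ.[ℂ] H) (p c : ℝ) : Prop :=
  ∃ h : T.domain ≤ A.domain, ∀ x : T.domain,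
    ‖A ⟨x, h x.2⟩‖ ≤ c * ‖(x : H)‖ ^ (1 - p) * ‖T x‖ ^ p

end UnboundedOp

namespace UnboundedOp

/-! ### Graphs and resolvents -/

section Graph

variable {H : Type*} [NormedAddCommGroup H] [InnerProductSpace ℂ H]

/-! Let `M = max(|α + iγ|, |β + iγ|)` and let `d` be the distance from `Re z` to the nearer of `α`,
`β`; the narrowed strip is where `c M ^ p < d`. The resolvent `R = (T - z)⁻¹` is normal, so norms of
`R` and `T R = 1 + z R` are spectral radii, bounded via `1 / (w - z)` and `w / (w - z)` with `w ∈
σ(T)`. This gives `‖R‖ ≤ 1 / d` and `‖T R‖ ≤ M / d`, subordination gives `‖A R‖ ≤ c M ^ p / d < 1`,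
and a Neumann series inverts `T + A - z = (1 + A R)(T - z)`. Normality of `R`
(`IsNormal.isStarNormal_resolvent`) needs `D(T) ⊆ D(T*)`, obtained from the density of `D(T* T)` in
`D(T)` for the graph norm. -/

theorem mem_prod_graph_iff (S T : H →ₗ.[ℂ] H) (x w : H) :
    (x, w) ∈ (prod S T).graph ↔ ∃ y, (x, y) ∈ T.graph ∧ (y, w) ∈ S.graph := by
  simp only [LinearPMap.mem_graph_iff]
  constructor
  · rintro ⟨⟨x', hx'⟩, rfl, rfl⟩
    obtain ⟨⟨a, ha, rfl⟩, hxT⟩ := hx'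
    exact ⟨T a, ⟨a, rfl, rfl⟩, ⟨⟨T a, ha⟩, rfl, rfl⟩⟩
  · rintro ⟨y, ⟨a, rfl, rfl⟩, ⟨b, hb, rfl⟩⟩
    have ha : T a ∈ S.domain := hb ▸ b.2
    refine ⟨⟨a, ⟨⟨a, ha, rfl⟩, a.2⟩⟩, rfl, ?_⟩
    have : b = ⟨T a, ha⟩ := Subtype.ext hb
    rw [this]
    rfl

/-- `R` is the inverse of `T - z`, expressed through the graph of `T`. -/
def IsResolventAt (T : H →ₗ.[ℂ] H) (z : ℂ) (R : H →L[ℂ] H) : Prop :=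
  ∀ y w, R y = w ↔ (w, y + z • w) ∈ T.graph

theorem exists_isResolventAt {T : H →ₗ.[ℂ] H} {z : ℂ} (hz : z ∈ resolventSet T) :
    ∃ R : H →L[ℂ] H, IsResolventAt T z R := by
  obtain ⟨hbij, C, hC⟩ := hz
  let L : T.domain →ₗ[ℂ] H := T.toFun - z • T.domain.subtype
  let e : T.domain ≃ₗ[ℂ] H := LinearEquiv.ofBijective L hbij
  have he : ∀ x : T.domain, e x = T x - z • (x : H) := fun _ => rfl
  let R : H →L[ℂ] H := (T.domain.subtype ∘ₗ e.symm.toLinearMap).mkContinuous C fun y => by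
    simpa [← he] using hC (e.symm y)
  have hR : ∀ y, R y = e.symm y := fun _ => rfl
  refine ⟨R, fun y w => ?_⟩
  rw [hR, LinearPMap.mem_graph_iff]
  constructor
  · rintro rfl
    refine ⟨e.symm y, rfl, ?_⟩
    have := he (e.symm y)
    rw [e.apply_symm_apply] at this
    exact (sub_eq_iff_eq_add.1 this.symm)
  · rintro ⟨x, rfl, hx⟩
    simp only at hx
    have : e x = y := by rw [he, hx, add_sub_cancel_right]
    rw [← this, e.symm_apply_apply]

theorem IsResolventAt.isUnit_sub {T : H →ₗ.[ℂ] H} [CompleteSpace H] {z μ : ℂ} {R : H →L[ℂ] H}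
    (hR : IsResolventAt T z R) (hμ : μ ≠ 0) (h : z + μ⁻¹ ∈ resolventSet T) :
    IsUnit (algebraMap ℂ (H →L[ℂ] H) μ - R) := by
  obtain ⟨Q, hQ⟩ := exists_isResolventAt h
  have happ : ∀ x, (algebraMap ℂ (H →L[ℂ] H) μ - R) x = μ • x - R x := fun x => by
    simp [Algebra.algebraMap_eq_smul_one]
  rw [ContinuousLinearMap.isUnit_iff_bijective]
  constructor
  · rw [injective_iff_map_eq_zero]
    intro x hx
    rw [happ, sub_eq_zero, eq_comm, hR] at hx
    have : Q 0 = μ • x := by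
      rw [hQ]
      convert hx using 2
      rw [zero_add, add_smul, smul_smul μ⁻¹, inv_mul_cancel₀ hμ, one_smul, add_comm]
    rw [map_zero, eq_comm, smul_eq_zero] at this
    exact this.resolve_left hμ
  · intro y
    -- Resolvent identity: `(μ - R)⁻¹ = μ⁻¹ + μ⁻² Q`.
    refine ⟨μ⁻¹ • (y + Q (μ⁻¹ • y)), ?_⟩
    have : R (μ⁻¹ • (y + Q (μ⁻¹ • y))) = Q (μ⁻¹ • y) := by
      rw [hR]
      convert (hQ _ _).1 rfl using 2
      module
    rw [happ, this, smul_smul, mul_inv_cancel₀ hμ, one_smul, add_sub_cancel_right]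

/-- Points of the spectrum of the resolvent come from the spectrum of the operator. -/
theorem IsResolventAt.add_inv_mem_spectrum {T : H →ₗ.[ℂ] H} [CompleteSpace H] {z μ : ℂ}
    {R : H →L[ℂ] H} (hR : IsResolventAt T z R) (hμ : μ ≠ 0) (h : μ ∈ _root_.spectrum ℂ R) :
    z + μ⁻¹ ∈ spectrum T :=
  fun hmem => h (hR.isUnit_sub hμ hmem)

/-- The graph of `T` as a subspace of the Hilbert space `H × H`. -/
def l2Graph (T : H →ₗ.[ℂ] H) : Submodule ℂ (WithLp 2 (H × H)) :=
  T.graph.comap (WithLp.linearEquiv 2 ℂ (H × H)).toLinearMap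

theorem isClosed_l2Graph {T : H →ₗ.[ℂ] H} (hT : T.IsClosed) :
    IsClosed (l2Graph T : Set (WithLp 2 (H × H))) :=
  hT.preimage (WithLp.prod_continuous_ofLp 2 H H)

end Graph

/-! ### Normality of the resolvent -/

section Normal

variable {H : Type*} [NormedAddCommGroup H] [InnerProductSpace ℂ H] [CompleteSpace H]

theorem mem_adjoint_graph_iff {T : H →ₗ.[ℂ] H} (hT : Dense (T.domain : Set H)) (w v : H) :
    (w, v) ∈ T.adjoint.graph ↔ ∀ x : T.domain, inner ℂ v (x : H) = inner ℂ w (T x) := by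
  rw [LinearPMap.mem_graph_iff]
  constructor
  · rintro ⟨y, rfl, rfl⟩ x
    exact LinearPMap.adjoint_isFormalAdjoint hT y x
  · intro h
    exact ⟨⟨w, LinearPMap.mem_adjoint_domain_of_exists _ ⟨v, h⟩⟩, rfl,
      LinearPMap.adjoint_apply_eq hT _ h⟩

/-- The part of the graph of `T` over the domain of `T* T`. -/
noncomputable def l2GraphCore (T : H →ₗ.[ℂ] H) : Submodule ℂ (WithLp 2 (H × H)) :=
  l2Graph T ⊓ T.adjoint.domain.comap
    (LinearMap.snd ℂ H H ∘ₗ (WithLp.linearEquiv 2 ℂ (H × H)).toLinearMap)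

/-- The operator `1 + T* T` is surjective. -/
theorem exists_mem_graph_adjoint_mul_self {T : H →ₗ.[ℂ] H} (hd : Dense (T.domain : Set H))
    (hT : T.IsClosed) (y : H) : ∃ u v, (u, v) ∈ T.graph ∧ (v, y - u) ∈ T.adjoint.graph := by
  have : CompleteSpace (l2Graph T) := (isClosed_l2Graph hT).completeSpace_coe
  let e : WithLp 2 (H × H) := WithLp.toLp 2 (y, 0)
  -- Write `g = (u, T u)`. The residual `(y - u, -T u)` is orthogonal to the graph, which says
  -- exactly that `T* T u = y - u`.
  let g : WithLp 2 (H × H) := (l2Graph T).starProjection e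
  have hg : g ∈ l2Graph T := Submodule.starProjection_apply_mem _ _
  refine ⟨g.fst, g.snd, hg, (mem_adjoint_graph_iff hd _ _).2 fun x => ?_⟩
  have hx : WithLp.toLp 2 ((x : H), T x) ∈ l2Graph T := T.mem_graph x
  have := Submodule.starProjection_inner_eq_zero (K := l2Graph T) e _ hx
  rw [WithLp.prod_inner_apply] at this
  simp only [WithLp.ofLp_sub, Prod.fst_sub, Prod.snd_sub] at this
  change inner ℂ (y - g.fst) (x : H) + inner ℂ (0 - g.snd) (T x) = 0 at this
  rw [zero_sub, inner_neg_left] at this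
  exact sub_eq_zero.1 this

/-- If `(x, T x)` is orthogonal to the core, then `⟨(1 + T* T) u, x⟩ = 0` for all `u ∈ D(T* T)`;
choosing `(1 + T* T) u = x` forces `x = 0`. -/
theorem l2Graph_le_closure_core {T : H →ₗ.[ℂ] H} (hd : Dense (T.domain : Set H))
    (hT : T.IsClosed) : l2Graph T ≤ (l2GraphCore T).topologicalClosure := by
  intro g hg
  set K := (l2GraphCore T).topologicalClosure
  have : CompleteSpace K := (Submodule.isClosed_topologicalClosure _).completeSpace_coe
  have hK : K ≤ l2Graph T :=
    Submodule.topologicalClosure_minimal _ inf_le_left (isClosed_l2Graph hT)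
  have hP : K.starProjection g ∈ K := Submodule.starProjection_apply_mem _ _
  set h := g - K.starProjection g with hh
  have hhG : h ∈ l2Graph T := sub_mem hg (hK hP)
  have hfst : h.fst = 0 := by
    obtain ⟨u, v, huv, hv⟩ := exists_mem_graph_adjoint_mul_self hd hT h.fst
    have hmem : WithLp.toLp 2 (u, v) ∈ l2GraphCore T :=
      ⟨huv, LinearPMap.mem_domain_of_mem_graph hv⟩
    have h0 : inner ℂ (WithLp.toLp 2 (u, v)) h = 0 := by
      rw [← inner_conj_symm, Submodule.starProjection_inner_eq_zero (K := K) g _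
        (Submodule.le_topologicalClosure _ hmem), map_zero]
    rw [WithLp.prod_inner_apply] at h0
    change inner ℂ u h.fst + inner ℂ v h.snd = 0 at h0
    obtain ⟨x, hx1, hx2⟩ := (LinearPMap.mem_graph_iff _).1 hhG
    have hx1 : (x : H) = h.fst := hx1
    have hx2 : T x = h.snd := hx2
    have h1 := (mem_adjoint_graph_iff hd _ _).1 hv x
    rw [hx1, hx2] at h1
    rw [← h1, ← inner_add_left, add_sub_cancel] at h0
    exact inner_self_eq_zero.1 h0
  have hsnd : h.snd = 0 := LinearPMap.graph_fst_eq_zero_snd T hhG hfst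
  have h0 : h = 0 := (WithLp.equiv 2 (H × H)).injective (Prod.ext hfst hsnd)
  rw [hh, sub_eq_zero] at h0
  exact h0 ▸ hP

theorem IsNormal.exists_mem_graph {T : H →ₗ.[ℂ] H} (hT : IsNormal T) {x y w : H}
    (hxy : (x, y) ∈ T.graph) (hyw : (y, w) ∈ T.adjoint.graph) :
    ∃ v, (x, v) ∈ T.adjoint.graph ∧ (v, w) ∈ T.graph := by
  rw [← mem_prod_graph_iff, hT.comm, mem_prod_graph_iff]
  exact ⟨y, hxy, hyw⟩

/-- For `x ∈ D(T* T) = D(T T*)`, `‖T* x‖² = ⟨T T* x, x⟩ = ⟨T* T x, x⟩ = ‖T x‖²`, and Cauchy-Schwarz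
applies to `⟨T* x, a⟩`. The inequality is closed in the graph norm, so it passes from the core to
all of `D(T)`. -/
theorem IsNormal.norm_inner_le {T : H →ₗ.[ℂ] H} (hT : IsNormal T) {x y : H}
    (hxy : (x, y) ∈ T.graph) (a : T.domain) : ‖inner ℂ x (T a)‖ ≤ ‖y‖ * ‖(a : H)‖ := by
  have hd := hT.dense_domain
  have hclosed : IsClosed {g : WithLp 2 (H × H) |
      ‖inner ℂ g.fst (T a)‖ ≤ ‖g.snd‖ * ‖(a : H)‖} := by
    have h1 : Continuous fun g : WithLp 2 (H × H) => g.fst :=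
      continuous_fst.comp (WithLp.prod_continuous_ofLp 2 H H)
    have h2 : Continuous fun g : WithLp 2 (H × H) => g.snd :=
      continuous_snd.comp (WithLp.prod_continuous_ofLp 2 H H)
    exact isClosed_le (by fun_prop) (by fun_prop)
  have hmem := l2Graph_le_closure_core hd hT.isClosed
    (show WithLp.toLp 2 (x, y) ∈ l2Graph T from hxy)
  refine closure_minimal ?_ hclosed hmem
  rintro g ⟨hg1, hg2⟩
  obtain ⟨w, hw⟩ := LinearPMap.mem_domain_iff.1
    (show g.snd ∈ T.adjoint.domain from hg2)
  obtain ⟨v, hv1, hv2⟩ := hT.exists_mem_graph (x := g.fst) (y := g.snd) hg1 hw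
  have hnorm : ‖v‖ = ‖g.snd‖ := by
    obtain ⟨b, hb1, hb2⟩ := (LinearPMap.mem_graph_iff _).1 hg1
    obtain ⟨b', hb1', hb2'⟩ := (LinearPMap.mem_graph_iff _).1 hv2
    have e1 := (mem_adjoint_graph_iff hd _ _).1 hv1 b'
    have e2 := (mem_adjoint_graph_iff hd _ _).1 hw b
    have hb1 : (b : H) = g.fst := hb1
    have hb2 : T b = g.snd := hb2
    have e2 : inner ℂ w (b : H) = inner ℂ g.snd (T b) := e2
    simp only at hb1' hb2'
    rw [hb1', hb2'] at e1
    rw [hb1, hb2] at e2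
    have e3 : inner ℂ v v = inner ℂ g.snd g.snd := by
      rw [e1, ← inner_conj_symm, e2, inner_conj_symm]
    rw [inner_self_eq_norm_sq_to_K, inner_self_eq_norm_sq_to_K] at e3
    have e4 : ‖v‖ ^ 2 = ‖g.snd‖ ^ 2 := by exact_mod_cast e3
    exact (pow_left_inj₀ (norm_nonneg _) (norm_nonneg _) two_ne_zero).1 e4
  rw [Set.mem_ofPred_eq, ← (mem_adjoint_graph_iff hd _ _).1 hv1 a, ← hnorm]
  exact norm_inner_le_norm _ _

/-- The domain of a normal operator is contained in the domain of its adjoint. -/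
theorem IsNormal.domain_le_adjoint {T : H →ₗ.[ℂ] H} (hT : IsNormal T) :
    T.domain ≤ T.adjoint.domain := by
  intro x hx
  rw [LinearPMap.mem_adjoint_domain_iff]
  refine AddMonoidHomClass.continuous_of_bound
    ((innerₛₗ ℂ x).comp T.toFun) ‖T ⟨x, hx⟩‖ fun a => ?_
  exact hT.norm_inner_le (T.mem_graph ⟨x, hx⟩) a

theorem IsResolventAt.adjoint {T : H →ₗ.[ℂ] H} (hd : Dense (T.domain : Set H)) {z : ℂ}
    {R : H →L[ℂ] H} (hR : IsResolventAt T z R) :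
    IsResolventAt T.adjoint (starRingEnd ℂ z) (ContinuousLinearMap.adjoint R) := by
  intro v w
  rw [mem_adjoint_graph_iff hd]
  have hRx : ∀ x : T.domain, R (T x - z • (x : H)) = x := fun x => by
    rw [hR, sub_add_cancel]
    exact T.mem_graph x
  constructor
  · rintro rfl x
    have := ContinuousLinearMap.adjoint_inner_left R (T x - z • (x : H)) v
    rw [hRx, inner_sub_right, inner_smul_right] at this
    rw [inner_add_left, inner_smul_left, ← this]
    simp
  · intro h
    refine ext_inner_right ℂ fun y => ?_
    rw [ContinuousLinearMap.adjoint_inner_left]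
    obtain ⟨x, hx1, hx2⟩ := (LinearPMap.mem_graph_iff _).1 ((hR y _).1 rfl)
    simp only at hx1 hx2
    have := h x
    rw [hx1, hx2, inner_add_left, inner_smul_left, inner_add_right, inner_smul_right] at this
    simpa using this

theorem IsNormal.isStarNormal_resolvent {T : H →ₗ.[ℂ] H} (hT : IsNormal T) {z : ℂ}
    {R : H →L[ℂ] H} (hR : IsResolventAt T z R) : IsStarNormal R := by
  have hR' := hR.adjoint hT.dense_domain
  refine ⟨ContinuousLinearMap.ext fun y => ?_⟩
  rw [ContinuousLinearMap.star_eq_adjoint]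
  change (ContinuousLinearMap.adjoint R) (R y) = R ((ContinuousLinearMap.adjoint R) y)
  set v := (ContinuousLinearMap.adjoint R) y with hv
  set u := R v with hu
  have hvg := (hR' y v).1 hv.symm
  have hug := (hR v u).1 hu.symm
  -- `T u = v + z u` lies in `D(T*)` only because `u` does. Commutation then gives `(T - z)(T* - z̄)
  -- u = (T* - z̄)(T - z) u = y`, hence `u = R* R y`.
  obtain ⟨s, hs⟩ := LinearPMap.mem_domain_iff.1
    (hT.domain_le_adjoint (LinearPMap.mem_domain_of_mem_graph hug))
  obtain ⟨s', hs', hs'T⟩ := hT.exists_mem_graph hug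
    (add_mem hvg (T.adjoint.graph.smul_mem z hs))
  obtain rfl := T.adjoint.mem_graph_snd_inj hs hs' rfl
  have ht : R y = s - (starRingEnd ℂ z) • u := by
    rw [hR]
    convert sub_mem hs'T (T.graph.smul_mem (starRingEnd ℂ z) hug) using 1
    refine Prod.ext rfl ?_
    change y + z • (s - (starRingEnd ℂ z) • u) =
      (y + (starRingEnd ℂ z) • v) + z • s - (starRingEnd ℂ z) • (v + z • u)
    module
  rw [hR', ht, sub_add_cancel]
  exact hs

end Normal

/-! ### Resolvent bounds and the Neumann series -/

section Estimates

theorem norm_le_of_forall_mem_spectrum {B : Type*} [CStarAlgebra B] (N : B) [IsStarNormal N]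
    {C : ℝ} (hC : 0 ≤ C) (h : ∀ μ ∈ _root_.spectrum ℂ N, ‖μ‖ ≤ C) : ‖N‖ ≤ C := by
  have h1 : (‖N‖₊ : ENNReal) ≤ (C.toNNReal : ENNReal) := by
    rw [← IsStarNormal.spectralRadius_eq_nnnorm N]
    refine iSup₂_le fun μ hμ => ?_
    rw [ENNReal.coe_le_coe]
    exact (Real.le_toNNReal_iff_coe_le hC).2 (h μ hμ)
  exact (Real.le_toNNReal_iff_coe_le hC).1 (ENNReal.coe_le_coe.1 h1)

theorem norm_le_norm_re_add_I_mul {w : ℂ} {γ : ℝ} (h : |w.im| ≤ γ) :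
    ‖w‖ ≤ ‖(w.re : ℂ) + Complex.I * γ‖ := by
  rw [mul_comm, Complex.norm_add_mul_I, Complex.norm_eq_sqrt_sq_add_sq]
  have := sq_le_sq.2 (h.trans (le_abs_self γ))
  gcongr

theorem norm_le_add_abs_sub {w : ℂ} {γ : ℝ} (h : |w.im| ≤ γ) (a : ℝ) :
    ‖w‖ ≤ ‖(a : ℂ) + Complex.I * γ‖ + |w.re - a| := by
  refine (norm_le_norm_re_add_I_mul h).trans ?_
  have : (w.re : ℂ) + Complex.I * γ = ((a : ℂ) + Complex.I * γ) + ((w.re - a : ℝ) : ℂ) := by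
    push_cast; ring
  rw [this]
  refine (norm_add_le _ _).trans ?_
  rw [Complex.norm_real, Real.norm_eq_abs]

theorem abs_le_norm_add_I_mul (a γ : ℝ) : |a| ≤ ‖(a : ℂ) + Complex.I * γ‖ := by
  simpa using Complex.abs_re_le_norm ((a : ℂ) + Complex.I * γ)

/-- `2d ≤ β - α ≤ |β| + |α| ≤ 2M`. -/
theorem le_of_le_sub_of_le_sub {α β γ x d M : ℝ} (hα : d ≤ x - α) (hβ : d ≤ β - x)
    (hMα : ‖(α : ℂ) + Complex.I * γ‖ ≤ M) (hMβ : ‖(β : ℂ) + Complex.I * γ‖ ≤ M) : d ≤ M := by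
  have h1 := (neg_le_abs α).trans ((abs_le_norm_add_I_mul α γ).trans hMα)
  have h2 := (le_abs_self β).trans ((abs_le_norm_add_I_mul β γ).trans hMβ)
  linarith

/-- If `w` lies at horizontal distance `s` outside the strip, then `|w| ≤ M + s` and `|w - z| ≥ d +
s`; since `d ≤ M`, `(M + s) d ≤ M (d + s)`. -/
theorem norm_mul_le_mul_norm_sub {α β γ d M : ℝ} {w z : ℂ} (hd : 0 < d) (hα : d ≤ z.re - α)
    (hβ : d ≤ β - z.re) (hMα : ‖(α : ℂ) + Complex.I * γ‖ ≤ M)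
    (hMβ : ‖(β : ℂ) + Complex.I * γ‖ ≤ M) (hre : w.re ≤ α ∨ β ≤ w.re) (him : |w.im| ≤ γ) :
    ‖w‖ * d ≤ M * ‖w - z‖ := by
  have hdM := le_of_le_sub_of_le_sub hα hβ hMα hMβ
  have hn : |w.re - z.re| ≤ ‖w - z‖ := by simpa using Complex.abs_re_le_norm (w - z)
  have hM : 0 ≤ M := hd.le.trans hdM
  suffices h : ‖w‖ * d ≤ M * |w.re - z.re| from h.trans (mul_le_mul_of_nonneg_left hn hM)
  rcases hre with h | h
  · have h1 := norm_le_add_abs_sub him α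
    rw [abs_of_nonpos (by linarith)] at h1
    rw [abs_of_nonpos (by linarith)]
    nlinarith [mul_le_mul_of_nonneg_right (h1.trans (add_le_add_left hMα _)) hd.le,
      mul_le_mul_of_nonneg_left hα hM, mul_le_mul_of_nonneg_right hdM (sub_nonneg.2 h)]
  · have h1 := norm_le_add_abs_sub him β
    rw [abs_of_nonneg (by linarith)] at h1
    rw [abs_of_nonneg (by linarith)]
    nlinarith [mul_le_mul_of_nonneg_right (h1.trans (add_le_add_left hMβ _)) hd.le,
      mul_le_mul_of_nonneg_left hβ hM, mul_le_mul_of_nonneg_right hdM (sub_nonneg.2 h)]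

theorem le_norm_sub_of_re {α β d : ℝ} {w z : ℂ} (hα : d ≤ z.re - α)
    (hβ : d ≤ β - z.re) (hre : w.re ≤ α ∨ β ≤ w.re) : d ≤ ‖w - z‖ := by
  have hn : |w.re - z.re| ≤ ‖w - z‖ := by simpa using Complex.abs_re_le_norm (w - z)
  have h1 := le_abs_self (w.re - z.re)
  have h2 := neg_le_abs (w.re - z.re)
  rcases hre with h | h <;> linarith

variable {H : Type*} [NormedAddCommGroup H] [InnerProductSpace ℂ H] [CompleteSpace H]

theorem IsNormal.norm_resolvent_le {T : H →ₗ.[ℂ] H} (hT : IsNormal T) {z : ℂ} {R : H →L[ℂ] H}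
    (hR : IsResolventAt T z R) {d : ℝ} (hd : 0 < d) (h : ∀ w ∈ spectrum T, d ≤ ‖w - z‖) :
    ‖R‖ ≤ d⁻¹ := by
  have := hT.isStarNormal_resolvent hR
  refine norm_le_of_forall_mem_spectrum R (inv_nonneg.2 hd.le) fun μ hμ => ?_
  rcases eq_or_ne μ 0 with rfl | h0
  · simpa using hd.le
  · have h1 := h _ (hR.add_inv_mem_spectrum h0 hμ)
    rw [add_sub_cancel_left, norm_inv] at h1
    exact (le_inv_comm₀ hd (norm_pos_iff.2 h0)).1 h1

/-- A spectral value `μ = 1 / (w - z)` of `R` becomes `1 + z μ = w / (w - z)`. The value `μ = 0`,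
present when `T` is unbounded, becomes `1`, whence the condition `1 ≤ K`. -/
theorem IsNormal.norm_one_add_smul_resolvent_le {T : H →ₗ.[ℂ] H} (hT : IsNormal T) {z : ℂ}
    {R : H →L[ℂ] H} (hR : IsResolventAt T z R) {K : ℝ} (hK : 1 ≤ K)
    (h : ∀ w ∈ spectrum T, ‖w‖ ≤ K * ‖w - z‖) : ‖(1 : H →L[ℂ] H) + z • R‖ ≤ K := by
  have hn := hT.isStarNormal_resolvent hR
  have hn' : IsStarNormal ((1 : H →L[ℂ] H) + z • R) := by
    refine ⟨?_⟩
    rw [star_add, star_one, star_smul]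
    have := hn.star_comm_self
    exact ((Commute.one_left _).add_left (((Commute.one_right _).add_right
      ((this.smul_left _).smul_right _))))
  refine norm_le_of_forall_mem_spectrum _ (zero_le_one.trans hK) fun ν hν => ?_
  have hν' : ν - 1 ∈ _root_.spectrum ℂ (z • R) := by
    rw [spectrum.mem_iff] at hν ⊢
    rwa [map_sub, map_one, sub_sub]
  rcases eq_or_ne ν 1 with rfl | hν1
  · simpa using hK
  have hz : z ≠ 0 := by
    rintro rfl
    rw [zero_smul, spectrum.mem_iff, sub_zero] at hν'
    exact hν' ((IsUnit.mk0 _ (sub_ne_zero.2 hν1)).map (algebraMap ℂ (H →L[ℂ] H)))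
  set μ := z⁻¹ * (ν - 1) with hμ
  have hμ0 : μ ≠ 0 := mul_ne_zero (inv_ne_zero hz) (sub_ne_zero.2 hν1)
  have hzμ : z * μ = ν - 1 := by rw [hμ, mul_inv_cancel_left₀ hz]
  have hμR : μ ∈ _root_.spectrum ℂ R := by
    rw [spectrum.mem_iff] at hν' ⊢
    intro hu
    apply hν'
    have : algebraMap ℂ (H →L[ℂ] H) (ν - 1) - z • R = algebraMap ℂ (H →L[ℂ] H) z *
        (algebraMap ℂ (H →L[ℂ] H) μ - R) := by
      rw [← hzμ, map_mul, mul_sub, Algebra.smul_def]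
    rw [this]
    exact ((IsUnit.mk0 _ hz).map (algebraMap ℂ (H →L[ℂ] H))).mul hu
  have h1 := h _ (hR.add_inv_mem_spectrum hμ0 hμR)
  rw [add_sub_cancel_left, norm_inv] at h1
  have h2 : ν = (z + μ⁻¹) * μ := by
    rw [add_mul, inv_mul_cancel₀ hμ0, hzμ, sub_add_cancel]
  rw [h2, norm_mul]
  calc _ ≤ K * ‖μ‖⁻¹ * ‖μ‖ := by gcongr
    _ = K := by rw [mul_assoc, inv_mul_cancel₀ (norm_ne_zero_iff.2 hμ0), mul_one]

/-- If `A (T - z)⁻¹` has norm less than one, then `z` is in the resolvent set of `T + A`. -/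
theorem IsResolventAt.mem_resolventSet_add {T A : H →ₗ.[ℂ] H} (hdom : T.domain ≤ A.domain) {z : ℂ}
    {R : H →L[ℂ] H} (hR : IsResolventAt T z R) {q : ℝ} (hq0 : 0 ≤ q) (hq : q < 1)
    (hA : ∀ x : T.domain, ‖A ⟨x, hdom x.2⟩‖ ≤ q * ‖T x - z • (x : H)‖) :
    z ∈ resolventSet (T + A) := by
  have hRx : ∀ x : T.domain, R (T x - z • (x : H)) = x := fun x => by
    rw [hR, sub_add_cancel]
    exact T.mem_graph x
  have hRd : ∀ y, R y ∈ T.domain := fun y =>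
    LinearPMap.mem_domain_of_mem_graph ((hR y _).1 rfl)
  have hRT : ∀ y, T ⟨R y, hRd y⟩ - z • R y = y := fun y => by
    rw [sub_eq_iff_eq_add]
    exact T.mem_graph_snd_inj (T.mem_graph _) ((hR y _).1 rfl) rfl
  -- `B = A R` is bounded by `q < 1`, so `U = 1 + B` is invertible and `T + A - z = U (T - z)`.
  let B₀ : H →ₗ[ℂ] H :=
    A.toFun ∘ₗ (R : H →ₗ[ℂ] H).codRestrict A.domain fun y => hdom (hRd y)
  let B : H →L[ℂ] H := B₀.mkContinuous q fun y => by
    have := hA ⟨R y, hRd y⟩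
    rwa [hRT] at this
  have hB : ‖B‖ < 1 := (LinearMap.mkContinuous_norm_le _ hq0 _).trans_lt hq
  have hBx : ∀ x : T.domain, B (T x - z • (x : H)) = A ⟨x, hdom x.2⟩ := fun x => by
    change A _ = A _
    congr 1
    exact Subtype.ext (hRx x)
  have hu : IsUnit (1 + B) := by
    simpa using isUnit_one_sub_of_norm_lt_one (x := -B) (by rwa [norm_neg])
  obtain ⟨U, hU⟩ := hu
  have hUB : ∀ y, (U : H →L[ℂ] H) y = y + B y := fun y => by rw [hU]; rfl
  have hinv : ∀ y, (↑U⁻¹ : H →L[ℂ] H) ((U : H →L[ℂ] H) y) = y := fun y => by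
    rw [← mul_apply_eq_comp, Units.inv_mul, one_apply_eq_self]
  have hinv' : ∀ y, (U : H →L[ℂ] H) ((↑U⁻¹ : H →L[ℂ] H) y) = y := fun y => by
    rw [← mul_apply_eq_comp, Units.mul_inv, one_apply_eq_self]
  have key : ∀ x : (T + A).domain, (T + A) x - z • (x : H) =
      (U : H →L[ℂ] H) (T ⟨x, x.2.1⟩ - z • (x : H)) := fun x => by
    rw [hUB, hBx ⟨x, x.2.1⟩, LinearPMap.add_apply]
    abel
  have hrec : ∀ x : (T + A).domain,
      R ((↑U⁻¹ : H →L[ℂ] H) ((T + A) x - z • (x : H))) = x := fun x => by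
    rw [key, hinv]
    exact hRx ⟨x, x.2.1⟩
  refine ⟨⟨fun x x' hxx' => Subtype.ext ?_, fun y => ?_⟩,
    ‖R * (↑U⁻¹ : H →L[ℂ] H)‖, fun x => ?_⟩
  · rw [← hrec x, ← hrec x']
    exact congrArg (fun y => R ((↑U⁻¹ : H →L[ℂ] H) y)) hxx'
  · refine ⟨⟨R ((↑U⁻¹ : H →L[ℂ] H) y), hRd _, hdom (hRd _)⟩, ?_⟩
    simp only
    rw [key]
    simp only
    rw [hRT, hinv']
  · conv_lhs => rw [← hrec x]
    exact ContinuousLinearMap.le_opNorm (R * (↑U⁻¹ : H →L[ℂ] H)) _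

/-- The exponents `1 - p` and `p` sum to one, so `r / d` comes out to the first power and only `M`
keeps the exponent `p`. -/
theorem subordinate_bound {p c d M a b r : ℝ} (hp0 : 0 ≤ p) (hp1 : p ≤ 1) (hc : 0 ≤ c)
    (hd : 0 < d) (hM : 0 ≤ M) (hr : 0 ≤ r) (ha0 : 0 ≤ a) (hb0 : 0 ≤ b) (ha : a ≤ d⁻¹ * r)
    (hb : b ≤ M / d * r) : c * a ^ (1 - p) * b ^ p ≤ c * M ^ p / d * r := by
  have hs : 0 ≤ d⁻¹ * r := by positivity
  calc c * a ^ (1 - p) * b ^ p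
      ≤ c * (d⁻¹ * r) ^ (1 - p) * (M * (d⁻¹ * r)) ^ p := by
        have hb' : b ≤ M * (d⁻¹ * r) := by rwa [← mul_assoc, ← div_eq_mul_inv]
        have := sub_nonneg.2 hp1
        gcongr
    _ = c * M ^ p * ((d⁻¹ * r) ^ (1 - p) * (d⁻¹ * r) ^ p) := by
        rw [Real.mul_rpow hM hs]; ring
    _ = c * M ^ p / d * r := by
        rw [← Real.rpow_add_of_nonneg hs (sub_nonneg.2 hp1) hp0, sub_add_cancel, Real.rpow_one]
        ring

end Estimates

end UnboundedOp

/-! ### Persistence of the spectral gap -/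

open UnboundedOp in
theorem mainTheorem8 {H : Type*} [NormedAddCommGroup H] [InnerProductSpace ℂ H] [CompleteSpace H]
    (T A : H →ₗ.[ℂ] H) (hT : UnboundedOp.IsNormal T)
    (p c : ℝ) (hp0 : 0 ≤ p) (hp1 : p ≤ 1) (hc : 0 ≤ c)
    (hA : UnboundedOp.IsSubordinateWith A T p c)
    (α β γ : ℝ) (hαβ : α < β) (hγ : 0 ≤ γ)
    (hstrip : {z : ℂ | α < z.re ∧ z.re < β} ⊆ UnboundedOp.resolventSet T)
    (him : Complex.im '' UnboundedOp.spectrum T ⊆ Set.Icc (-γ) γ)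
    (hgap : 2 * c * max (‖(α : ℂ) + Complex.I * γ‖ ^ p) (‖(β : ℂ) + Complex.I * γ‖ ^ p) < β - α) :
    {z : ℂ | α + c * max (‖(α : ℂ) + Complex.I * γ‖ ^ p) (‖(β : ℂ) + Complex.I * γ‖ ^ p) < z.re ∧
        z.re < β - c * max (‖(α : ℂ) + Complex.I * γ‖ ^ p) (‖(β : ℂ) + Complex.I * γ‖ ^ p)} ⊆
      UnboundedOp.resolventSet (T + A) := by
  rintro z ⟨hz1, hz2⟩
  set M := max ‖(α : ℂ) + Complex.I * γ‖ ‖(β : ℂ) + Complex.I * γ‖ with hM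
  have hM0 : 0 ≤ M := le_max_of_le_left (norm_nonneg _)
  have hMp : max (‖(α : ℂ) + Complex.I * γ‖ ^ p) (‖(β : ℂ) + Complex.I * γ‖ ^ p) = M ^ p := by
    rcases le_total ‖(α : ℂ) + Complex.I * γ‖ ‖(β : ℂ) + Complex.I * γ‖ with h | h
    · rw [hM, max_eq_right h,
        max_eq_right (Real.rpow_le_rpow (norm_nonneg _) h hp0)]
    · rw [hM, max_eq_left h,
        max_eq_left (Real.rpow_le_rpow (norm_nonneg _) h hp0)]
  rw [hMp] at hz1 hz2
  have hcM : 0 ≤ c * M ^ p := by positivity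
  set d := min (z.re - α) (β - z.re) 
  have hdα : d ≤ z.re - α := min_le_left _ _
  have hdβ : d ≤ β - z.re := min_le_right _ _
  have hcd : c * M ^ p < d := lt_min (by linarith) (by linarith)
  have hd : 0 < d := hcM.trans_lt hcd
  have hre : ∀ w ∈ UnboundedOp.spectrum T, w.re ≤ α ∨ β ≤ w.re := fun w hw => by
    by_contra! h
    exact hw (hstrip h)
  have him' : ∀ w ∈ UnboundedOp.spectrum T, |w.im| ≤ γ := fun w hw =>
    abs_le.2 (him ⟨w, hw, rfl⟩)
  have hMα := le_max_left ‖(α : ℂ) + Complex.I * γ‖ ‖(β : ℂ) + Complex.I * γ‖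
  have hMβ := le_max_right ‖(α : ℂ) + Complex.I * γ‖ ‖(β : ℂ) + Complex.I * γ‖
  obtain ⟨R, hR⟩ := exists_isResolventAt (T := T) (z := z)
    (hstrip ⟨by linarith, by linarith⟩)
  have hnR := hT.norm_resolvent_le hR hd fun w hw => le_norm_sub_of_re hdα hdβ (hre w hw)
  have hnTR := hT.norm_one_add_smul_resolvent_le hR (K := M / d)
    ((one_le_div hd).2 (le_of_le_sub_of_le_sub hdα hdβ hMα hMβ)) fun w hw => by
      rw [div_mul_eq_mul_div, le_div_iff₀ hd]
      exact norm_mul_le_mul_norm_sub hd hdα hdβ hMα hMβ (hre w hw) (him' w hw)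
  obtain ⟨hdom, hsub⟩ := hA
  refine hR.mem_resolventSet_add hdom (q := c * M ^ p / d) (by positivity)
    ((div_lt_one hd).2 hcd) fun x => (hsub x).trans ?_
  have hRx : R (T x - z • (x : H)) = x := by
    rw [hR, sub_add_cancel]
    exact T.mem_graph x
  have hTx : ((1 : H →L[ℂ] H) + z • R) (T x - z • (x : H)) = T x := by
    change (T x - z • (x : H)) + z • R (T x - z • (x : H)) = T x
    rw [hRx, sub_add_cancel]
  -- With `r = ‖(T - z) x‖`, the bounds on `R` and `1 + z R` control `‖x‖` and `‖T x‖` respectively.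
  refine subordinate_bound hp0 hp1 hc hd hM0 (norm_nonneg _) (norm_nonneg _) (norm_nonneg _) ?_ ?_
  · conv_lhs => rw [← hRx]
    exact R.le_of_opNorm_le hnR _
  · conv_lhs => rw [← hTx]
    exact ContinuousLinearMap.le_of_opNorm_le _ hnTR _
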